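/- Let $k,l\ge 1$ be fixed integers, let $\sigma_a,\sigma_z>0$, and write $[m]=\{1,\dots,m\}$. For $m\ge k$ let $\mathbf S=(S_1,\dots,S_k)$ be drawn uniformly at random from $[m]$ without replacement. For a matrix $W\in\mathbb R^{k\times l}$ with all entries nonzero, let $X=X(W,\mathbf S)\in\mathbb R^{m\times l}$ be the matrix whose $S_j$-th row is the $j$-th row of $W$ for $j\in[k]$ and whose other rows vanish, and let $\operatorname{supp}(X)=\{S_1,\dots,S_k\}$ be the set of indices of its nonzero rows. One observes $$Y=AX+Z\in\mathbb R^{n_m\times l},$$ where $n_m\ge 1$, the entries of $A\in\mathbb R^{n_m\times m}$ are i.i.d. $\mathcal N(0,\sigma_a^2)$, the entries of $Z\in\mathbb R^{n_m\times l}$ are i.i.d. $\mathcal N(0,\sigma_z^2)$, and $\mathbf S$, $A$, $Z$ are independent. A support recovery map $d^{(m)}$ assigns to the (known) measurement matrix $A$ and the observation $Y$ a subset $d^{(m)}(A,Y)\subseteq[m]$, measurably in $(A,Y)$; it does not know $W$, $\mathbf S$ or $Z$. Let $$c(W)=\min_{\emptyset\ne T\subseteq[k]}\ \frac1{2|T|}\log\det\Bigl(I+\frac{\sigma_a^2}{\sigma_z^2}W_T^{\top}W_T\Bigr),$$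 where $W_T$ is the submatrix of $W$ formed by the rows indexed by $T$ and $\log$ is the natural logarithm. Then for every sequence $(n_m)_{m\ge k}$ of positive integers there is a sequence of support recovery maps $(d^{(m)})_{m\ge k}$, not depending on $W$, such that for every $W\in\mathbb R^{k\times l}$ with all entries nonzero and $$\limsup_{m\to\infty}\frac{\log m}{n_m}<c(W)$$ the average probability of error, taken over $\mathbf S$, $A$ and $Z$, satisfies $$\lim_{m\to\infty}\mathbb P\bigl\{d^{(m)}(A,Y)\ne\operatorname{supp}(X(W,\mathbf S))\bigr\}=0 .$$ In particular, for each fixed such $W$ there is a sequence of support recovery maps with average error probability tending to $0$. -/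

import Mathlib

open MeasureTheory ProbabilityTheory Filter Topology

namespace SupportRecovery

noncomputable section

/-- Matrices carry the product (Borel) σ-algebra of their entries. -/
instance instMeasurableSpaceMatrix {p q : ℕ} : MeasurableSpace (Matrix (Fin p) (Fin q) ℝ) :=
  inferInstanceAs (MeasurableSpace (Fin p → Fin q → ℝ))

/-- The rate threshold
`c(W) = min_T (1 / (2|T|)) log det (I + (σa² / σz²) W_Tᵀ W_T)`,
where `T` runs over the nonempty subsets of the row index set and `W_T` is the submatrix
formed by the rows of `W` indexed by `T` (the infimum is over a finite set). -/
def threshold {k l : ℕ} (σa σz : ℝ) (W : Matrix (Fin k) (Fin l) ℝ) : ℝ :=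
  ⨅ T : {T : Finset (Fin k) // T.Nonempty},
    1 / (2 * (T.1.card : ℝ)) *
      Real.log (Matrix.det
        (1 + (σa ^ 2 / σz ^ 2) •
          ((W.submatrix (fun i : T.1 => (i : Fin k)) id).transpose *
            W.submatrix (fun i : T.1 => (i : Fin k)) id)))

/-- The signal `X(W, S)`: row `S j` of `X` is row `j` of `W`, all other rows vanish.
(For injective `S`, at most one summand is nonzero.) -/
def signal {k l m : ℕ} (W : Matrix (Fin k) (Fin l) ℝ) (S : Fin k → Fin m) :
    Matrix (Fin m) (Fin l) ℝ :=
  Matrix.of fun s i => ∑ j : Fin k, if s = S j then W j i else 0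

/-- The support of a matrix: the set of indices of its nonzero rows. -/
def rowSupport {m l : ℕ} (X : Matrix (Fin m) (Fin l) ℝ) : Set (Fin m) :=
  {s | ∃ i, X s i ≠ 0}

/-- The law of a `p × q` matrix with i.i.d. `N(0, σ²)` entries. -/
def gaussianMatrix (p q : ℕ) (σ : ℝ) : Measure (Matrix (Fin p) (Fin q) ℝ) :=
  (Measure.pi fun _ : Fin p => Measure.pi fun _ : Fin q =>
    gaussianReal 0 (Real.toNNReal (σ ^ 2)) : Measure (Fin p → Fin q → ℝ))

/-- The law of `S = (S_1, …, S_k)` drawn uniformly from `[m]` without replacement. -/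
def locationLaw (k m : ℕ) : Measure (Fin k → Fin m) :=
  uniformOn {S : Fin k → Fin m | Function.Injective S}

/-- The joint law of the independent triple `(S, A, Z)`: locations, `n × m` measurement matrix,
`n × l` noise matrix. -/
def modelLaw (k l m n : ℕ) (σa σz : ℝ) :
    Measure ((Fin k → Fin m) × Matrix (Fin n) (Fin m) ℝ × Matrix (Fin n) (Fin l) ℝ) :=
  (locationLaw k m).prod ((gaussianMatrix n m σa).prod (gaussianMatrix n l σz))

/-- The noisy measurement `Y = A X(W, S) + Z`. -/
def measurement {k l m n : ℕ} (W : Matrix (Fin k) (Fin l) ℝ)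
    (ω : (Fin k → Fin m) × Matrix (Fin n) (Fin m) ℝ × Matrix (Fin n) (Fin l) ℝ) :
    Matrix (Fin n) (Fin l) ℝ :=
  ω.2.1 * signal W ω.1 + ω.2.2

/-- The average probability of error `P{d(Y) ≠ supp X(W, S)}`, over `S`, `A` and `Z`. The support
recovery map is applied to `Y` and, like the receiver of the model, knows the realization of the
measurement matrix `A`. -/
def errorProb {k l m n : ℕ} (σa σz : ℝ) (W : Matrix (Fin k) (Fin l) ℝ)
    (d : Matrix (Fin n) (Fin m) ℝ → Matrix (Fin n) (Fin l) ℝ → Set (Fin m)) : ℝ :=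
  (modelLaw k l m n σa σz).real {ω | d ω.2.1 (measurement W ω) ≠ rowSupport (signal W ω.1)}

end

end SupportRecovery

namespace SupportRecovery

open scoped ENNReal Matrix

/-! ### Gaussian integrals and rank-one updates -/

/-! The decoder is a threshold test on information densities, made universal by a countable dense
sequence of candidate row matrices. For a candidate `(w, S')` and a nonempty set `T` of rows,
`infoDensity` is the log-likelihood ratio between "all coefficients explain `Y`" and "those in `T`
are unrelated to `Y`". A candidate is accepted if the sum over the `n` rows of the measurement is at
least `|T| log m + √n` for every `T`.

False acceptance. Let `T` be the set of rows that `S'` puts outside the true support. The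
coefficients in `T` are then independent of `Y` and of the other coefficients. Integrating them out
turns the numerator of the ratio into its denominator, so the exponential of the density has mean
one (`lintegral_exp_infoDensity_le_one`). This is an identity in the observed residual, so it holds
for every true `W` and every candidate `w`: mismatch costs nothing. By Markov each test is passed
with probability at most `m^(-|T|) exp(-√n)`. There are at most `k^k m^|T|` such `S'`, at most `2^k`
sets `T` and `n` candidate matrices, so the total is `O(n exp(-√n))`.

False rejection. At `w = W` the mean density per row is `(1/2) log det (gram T)`, which is at least
`|T| c(W)`. The mean is continuous in `w`, so one fixed grid point `i₀` keeps all means above `|T|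
R`, where `R` lies strictly between the limsup and `c(W)`. By Chebyshev the true locations are
accepted with this grid point with probability tending to one, the extra `√n` being negligible
against `n`. The rate condition forces `n → ∞`, so `i₀` is eventually among the `n` candidates
searched. -/

lemma exp_neg_half_log {t : ℝ} (ht : 0 < t) : Real.exp (-(Real.log t) / 2) = (√t)⁻¹ := by
  rw [neg_div, Real.exp_neg, ← Real.log_sqrt ht.le, Real.exp_log (Real.sqrt_pos.2 ht)]

/-- The integral of the exponential of a quadratic polynomial against a centred Gaussian. -/
lemma lintegral_exp_quadratic_gaussianReal {v s c : ℝ} (hv : 0 < v) (hs : 0 < s) (hc : 0 ≤ c)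
    (q b : ℝ) :
    ∫⁻ x, ENNReal.ofReal (Real.exp (-(q - 2 * b * x + c * x ^ 2) / (2 * s)))
        ∂gaussianReal 0 v.toNNReal =
      ENNReal.ofReal (Real.exp (-(Real.log (1 + v / s * c)) / 2
        - (q - v / s * b ^ 2 / (1 + v / s * c)) / (2 * s))) := by
  set t : ℝ := 1 + v / s * c with ht_def
  have ht : 0 < t := by positivity
  have hv0 : v.toNNReal ≠ 0 := by simpa using hv
  have hv' : 0 < v / t := by positivity
  have hv0' : (v / t).toNNReal ≠ 0 := by simpa using hv'
  rw [gaussianReal_of_var_ne_zero _ hv0,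
    lintegral_withDensity_eq_lintegral_mul _ (measurable_gaussianPDF _ _) (by fun_prop)]
  set C : ℝ := Real.exp (-(Real.log t) / 2 - (q - v / s * b ^ 2 / t) / (2 * s))
  -- Completing the square: the integrand is a constant times the Gaussian density with mean `v b /
  -- (s t)` and variance `v / t`, which integrates to one.
  have key : ∀ x, (gaussianPDF 0 v.toNNReal *
      fun x => ENNReal.ofReal (Real.exp (-(q - 2 * b * x + c * x ^ 2) / (2 * s)))) x =
      ENNReal.ofReal C * gaussianPDF (v / s * b / t) (v / t).toNNReal x := by
    intro x
    simp only [Pi.mul_apply, gaussianPDF]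
    rw [← ENNReal.ofReal_mul (gaussianPDFReal_nonneg _ _ _),
      ← ENNReal.ofReal_mul (Real.exp_pos _).le]
    congr 1
    simp only [gaussianPDFReal, Real.coe_toNNReal _ hv.le, Real.coe_toNNReal _ hv'.le]
    rw [sub_eq_add_neg (-Real.log t / 2), Real.exp_add, exp_neg_half_log ht]
    have h1 : √(2 * Real.pi * (v / t)) = √(2 * Real.pi * v) / √t := by
      rw [← Real.sqrt_div (by positivity)]; congr 1; ring
    have h2 : 0 < √t := Real.sqrt_pos.2 ht
    have h3 : 0 < √(2 * Real.pi * v) := Real.sqrt_pos.2 (by positivity)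
    have h4 : (√t)⁻¹ * (√(2 * Real.pi * (v / t)))⁻¹ = (√(2 * Real.pi * v))⁻¹ := by
      rw [h1]; field_simp
    have h5 : -(x - 0) ^ 2 / (2 * v) + -(q - 2 * b * x + c * x ^ 2) / (2 * s) =
        -((q - v / s * b ^ 2 / t) / (2 * s)) + -(x - v / s * b / t) ^ 2 / (2 * (v / t)) := by
      have : c = (t - 1) * s / v := by rw [ht_def]; field_simp; ring
      rw [this]; field_simp; ring
    calc _ = (√(2 * Real.pi * v))⁻¹ *
          (Real.exp (-(x - 0) ^ 2 / (2 * v)) *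
            Real.exp (-(q - 2 * b * x + c * x ^ 2) / (2 * s))) := by ring
      _ = _ := by rw [← Real.exp_add, h5, Real.exp_add, ← h4]; ring
  simp_rw [key]
  rw [lintegral_const_mul _ (measurable_gaussianPDF _ _), lintegral_gaussianPDF_eq_one _ hv0',
    mul_one]

section Matrices

variable {l : ℕ}

lemma det_add_smul_vecMulVec {M : Matrix (Fin l) (Fin l) ℝ} (hM : IsUnit M.det) (r : ℝ)
    (w : Fin l → ℝ) :
    (M + r • Matrix.vecMulVec w w).det = M.det * (1 + r * (w ⬝ᵥ M⁻¹ *ᵥ w)) := by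
  have h : r • Matrix.vecMulVec w w =
      Matrix.replicateCol Unit (r • w) * Matrix.replicateRow Unit w := by
    ext i j; simp [Matrix.mul_apply, Matrix.vecMulVec_apply, mul_assoc]
  rw [h, Matrix.det_add_replicateCol_mul_replicateRow hM]
  congr 1
  rw [Matrix.det_unique, Matrix.mul_assoc, ← Matrix.replicateCol_mulVec, Matrix.add_apply,
    Matrix.replicateRow_mul_replicateCol_apply, Matrix.mulVec_smul, dotProduct_smul]
  simp

lemma dotProduct_inv_mulVec_comm {M : Matrix (Fin l) (Fin l) ℝ} (hM : M.IsHermitian)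
    (v w : Fin l → ℝ) : v ⬝ᵥ M⁻¹ *ᵥ w = w ⬝ᵥ M⁻¹ *ᵥ v := by
  have h : (M⁻¹)ᵀ = M⁻¹ := by simpa [Matrix.IsSymm] using hM.inv
  rw [Matrix.dotProduct_mulVec, ← Matrix.mulVec_transpose, h, dotProduct_comm]

/-- The quadratic form of the inverse of a rank-one update (Sherman–Morrison). -/
lemma quadratic_inv_add_smul_vecMulVec {M : Matrix (Fin l) (Fin l) ℝ} (hM : M.PosDef) {r : ℝ}
    (hr : 0 ≤ r) (v w : Fin l → ℝ) :
    v ⬝ᵥ (M + r • Matrix.vecMulVec w w)⁻¹ *ᵥ v =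
      v ⬝ᵥ M⁻¹ *ᵥ v - r * (w ⬝ᵥ M⁻¹ *ᵥ v) ^ 2 / (1 + r * (w ⬝ᵥ M⁻¹ *ᵥ w)) := by
  have hdet : IsUnit M.det := hM.det_pos.ne'.isUnit
  have hc : 0 ≤ w ⬝ᵥ M⁻¹ *ᵥ w := by simpa using hM.inv.posSemidef.dotProduct_mulVec_nonneg w
  set b := w ⬝ᵥ M⁻¹ *ᵥ v with hb
  set c := w ⬝ᵥ M⁻¹ *ᵥ w with hc'
  have ht : 1 + r * c ≠ 0 := by positivity
  have hdet' : IsUnit (M + r • Matrix.vecMulVec w w).det := by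
    rw [det_add_smul_vecMulVec hdet]
    exact hdet.mul ht.isUnit
  -- The candidate for the inverse applied to `v` is checked as a solution of the linear system;
  -- invertibility of the update makes it the only one.
  have hsol : (M + r • Matrix.vecMulVec w w) *ᵥ (M⁻¹ *ᵥ v - (r * b / (1 + r * c)) • M⁻¹ *ᵥ w)
      = v := by
    have hMv : ∀ u : Fin l → ℝ, M *ᵥ M⁻¹ *ᵥ u = u := fun u => by
      rw [Matrix.mulVec_mulVec, Matrix.mul_nonsing_inv _ hdet, Matrix.one_mulVec]
    have hvw : ∀ u : Fin l → ℝ, Matrix.vecMulVec w w *ᵥ u = (w ⬝ᵥ u) • w := fun u => by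
      ext i; simp [Matrix.vecMulVec_mulVec, mul_comm]
    rw [Matrix.mulVec_sub, Matrix.mulVec_smul, Matrix.add_mulVec, Matrix.add_mulVec, hMv, hMv,
      Matrix.smul_mulVec, Matrix.smul_mulVec, hvw, hvw, ← hb, ← hc']
    ext i
    simp only [Pi.add_apply, Pi.sub_apply, Pi.smul_apply, smul_eq_mul]
    field_simp
    ring
  have hinv : (M + r • Matrix.vecMulVec w w)⁻¹ *ᵥ v =
      M⁻¹ *ᵥ v - (r * b / (1 + r * c)) • M⁻¹ *ᵥ w := by
    conv_lhs => rw [← hsol]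
    rw [Matrix.mulVec_mulVec, Matrix.nonsing_inv_mul _ hdet', Matrix.one_mulVec]
  rw [hinv, dotProduct_sub, dotProduct_smul, dotProduct_inv_mulVec_comm hM.isHermitian v w, ← hb]
  simp only [smul_eq_mul]
  ring

/-- The logarithm of the centred Gaussian density with covariance `s • M`, up to an additive
constant not depending on `M`. -/
noncomputable def logKernel (s : ℝ) (M : Matrix (Fin l) (Fin l) ℝ) (v : Fin l → ℝ) : ℝ :=
  -(Real.log M.det) / 2 - v ⬝ᵥ M⁻¹ *ᵥ v / (2 * s)

@[fun_prop]
lemma continuous_logKernel (s : ℝ) (M : Matrix (Fin l) (Fin l) ℝ) :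
    Continuous (logKernel s M) := by
  unfold logKernel
  simp only [dotProduct, Matrix.mulVec]
  fun_prop

/-- Adding an independent Gaussian multiple of `w` updates the covariance by `w wᵀ`. -/
lemma lintegral_exp_logKernel_sub_smul {v s : ℝ} (hv : 0 < v) (hs : 0 < s)
    {M : Matrix (Fin l) (Fin l) ℝ} (hM : M.PosDef) (u w : Fin l → ℝ) :
    ∫⁻ x, ENNReal.ofReal (Real.exp (logKernel s M (u - x • w))) ∂gaussianReal 0 v.toNNReal =
      ENNReal.ofReal (Real.exp (logKernel s (M + (v / s) • Matrix.vecMulVec w w) u)) := by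
  have hdet : IsUnit M.det := hM.det_pos.ne'.isUnit
  have hc : 0 ≤ w ⬝ᵥ M⁻¹ *ᵥ w := by simpa using hM.inv.posSemidef.dotProduct_mulVec_nonneg w
  have ht : 0 < 1 + v / s * (w ⬝ᵥ M⁻¹ *ᵥ w) := by positivity
  have h1 : ∀ x : ℝ, ENNReal.ofReal (Real.exp (logKernel s M (u - x • w))) =
      ENNReal.ofReal (Real.exp (-(Real.log M.det) / 2)) *
        ENNReal.ofReal (Real.exp (-(u ⬝ᵥ M⁻¹ *ᵥ u - 2 * (w ⬝ᵥ M⁻¹ *ᵥ u) * x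
          + (w ⬝ᵥ M⁻¹ *ᵥ w) * x ^ 2) / (2 * s))) := by
    intro x
    rw [← ENNReal.ofReal_mul (Real.exp_pos _).le, ← Real.exp_add]
    congr 2
    unfold logKernel
    simp only [Matrix.mulVec_sub, Matrix.mulVec_smul, sub_dotProduct, dotProduct_sub,
      dotProduct_smul, smul_dotProduct, smul_eq_mul,
      dotProduct_inv_mulVec_comm hM.isHermitian u w]
    ring
  simp_rw [h1]
  rw [lintegral_const_mul _ (by fun_prop), lintegral_exp_quadratic_gaussianReal hv hs hc,
    ← ENNReal.ofReal_mul (Real.exp_pos _).le, ← Real.exp_add]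
  congr 2
  unfold logKernel
  rw [quadratic_inv_add_smul_vecMulVec hM (by positivity), det_add_smul_vecMulVec hdet,
    Real.log_mul hdet.ne_zero ht.ne']
  ring

variable {ι : Type*}

/-- The normalized covariance matrix `1 + r ∑_{j ∈ T} w_j w_jᵀ`. -/
noncomputable def gram (r : ℝ) (w : ι → Fin l → ℝ) (T : Finset ι) : Matrix (Fin l) (Fin l) ℝ :=
  1 + r • ∑ j ∈ T, Matrix.vecMulVec (w j) (w j)

lemma gram_insert [DecidableEq ι] (r : ℝ) (w : ι → Fin l → ℝ) {T : Finset ι} {i : ι}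
    (hi : i ∉ T) : gram r w (insert i T) = gram r w T + r • Matrix.vecMulVec (w i) (w i) := by
  rw [gram, gram, Finset.sum_insert hi, smul_add]
  abel

lemma posDef_gram {r : ℝ} (hr : 0 ≤ r) (w : ι → Fin l → ℝ) (T : Finset ι) :
    (gram r w T).PosDef := by
  refine Matrix.PosDef.add_posSemidef Matrix.PosDef.one ?_
  refine Matrix.PosSemidef.smul (Matrix.posSemidef_sum _ fun j _ => ?_) hr
  simpa using Matrix.posSemidef_vecMulVec_self_star (w j)

/-- Integrating out the independent Gaussian coefficients indexed by `T`. -/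
lemma lmarginal_exp_logKernel [Fintype ι] [DecidableEq ι] {v s : ℝ} (hv : 0 < v) (hs : 0 < s)
    (w : ι → Fin l → ℝ) (T : Finset ι) (u : (ι → ℝ) → Fin l → ℝ) (hu : Measurable u)
    (huT : ∀ i ∈ T, ∀ x y, u (Function.update x i y) = u x) (x : ι → ℝ) :
    (∫⋯∫⁻_T, (fun x => ENNReal.ofReal (Real.exp (logKernel s 1 (u x - ∑ j ∈ T, x j • w j))))
      ∂(fun _ : ι => gaussianReal 0 v.toNNReal)) x =
      ENNReal.ofReal (Real.exp (logKernel s (gram (v / s) w T) (u x))) := by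
  induction T using Finset.induction_on generalizing u x with
  | empty => simp [gram]
  | insert i T hi ih =>
    have hmeas : Measurable fun x : ι → ℝ => ENNReal.ofReal
        (Real.exp (logKernel s 1 (u x - ∑ j ∈ insert i T, x j • w j))) := by
      refine ENNReal.measurable_ofReal.comp (Real.measurable_exp.comp
        ((continuous_logKernel s 1).measurable.comp (hu.sub ?_)))
      exact Finset.measurable_sum _ fun j _ => (measurable_pi_apply j).smul_const _
    rw [lmarginal_insert _ hmeas hi]
    -- The term of index `i` is absorbed into `u`, so the inner integral over `T` is known.
    -- Integrating over `x i` then adds the rank-one term to the covariance.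
    have h := ih (fun x => u x - x i • w i)
      (hu.sub ((measurable_pi_apply i).smul_const _))
      (fun j hj x y => by
        have hij : i ≠ j := fun h => hi (h ▸ hj)
        simp only [huT j (Finset.mem_insert_of_mem hj), Function.update_of_ne hij])
    simp_rw [Finset.sum_insert hi, ← sub_sub, h, huT i (Finset.mem_insert_self i T),
      Function.update_self]
    rw [lintegral_exp_logKernel_sub_smul hv hs (posDef_gram (by positivity) w T),
      gram_insert _ _ hi]

end Matrices

/-! ### Tail bounds for sums of independent identically distributed variables -/

section Tails

variable {E : Type*} [MeasurableSpace E] {μ : Measure E} [IsProbabilityMeasure μ]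

/-- Chernoff's bound at exponent one: independence makes the mean of the product of exponentials a
product of means, and Markov's inequality applies. -/
lemma pi_measure_le_sum_le_exp {f : E → ℝ} (hf : Measurable f)
    (h : ∫⁻ x, ENNReal.ofReal (Real.exp (f x)) ∂μ ≤ 1) (n : ℕ) (τ : ℝ) :
    (Measure.pi fun _ : Fin n => μ) {x | τ ≤ ∑ i, f (x i)} ≤ ENNReal.ofReal (Real.exp (-τ)) := by
  have hF : Measurable fun x => ENNReal.ofReal (Real.exp (f x)) := by fun_prop
  have hind : iIndepFun (fun (i : Fin n) (x : Fin n → E) => ENNReal.ofReal (Real.exp (f (x i))))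
      (Measure.pi fun _ : Fin n => μ) :=
    iIndepFun_pi (X := fun _ x => ENNReal.ofReal (Real.exp (f x))) fun _ => hF.aemeasurable
  have hint : ∫⁻ x, ∏ i, ENNReal.ofReal (Real.exp (f (x i))) ∂(Measure.pi fun _ : Fin n => μ)
      ≤ 1 := by
    rw [lintegral_prod_eq_prod_lintegral_of_indepFun _ _ hind
      fun i => hF.comp (measurable_pi_apply i)]
    refine Finset.prod_le_one' fun i _ => ?_
    rw [(measurePreserving_eval (fun _ : Fin n => μ) i).lintegral_comp hF]
    exact h
  have hsub : {x : Fin n → E | τ ≤ ∑ i, f (x i)} ⊆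
      {x | ENNReal.ofReal (Real.exp τ) ≤ ∏ i, ENNReal.ofReal (Real.exp (f (x i)))} := by
    intro x hx
    simp only [Set.mem_ofPred_eq] at hx ⊢
    rw [← ENNReal.ofReal_prod_of_nonneg fun _ _ => (Real.exp_pos _).le, ← Real.exp_sum]
    exact ENNReal.ofReal_le_ofReal (Real.exp_le_exp.2 hx)
  refine (measure_mono hsub).trans ?_
  refine (meas_ge_le_lintegral_div (Finset.measurable_prod _ fun i _ =>
    hF.comp (measurable_pi_apply i)).aemeasurable (by simp [Real.exp_pos]) (by simp)).trans ?_
  rw [Real.exp_neg, ENNReal.ofReal_inv_of_pos (Real.exp_pos _), ← one_div]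
  exact ENNReal.div_le_div_right hint _

/-- Chebyshev's inequality, with the variance of the sum equal to `n` times that of one term. -/
lemma pi_measure_sum_lt_le_variance {f : E → ℝ} (hf : MemLp f 2 μ) {n : ℕ} (hn : 0 < n) {δ : ℝ}
    (hδ : 0 < δ) :
    (Measure.pi fun _ : Fin n => μ) {x | ∑ i, f (x i) < n * (μ[f] - δ)} ≤
      ENNReal.ofReal (Var[f; μ] / (n * δ ^ 2)) := by
  set P : Measure (Fin n → E) := Measure.pi fun _ : Fin n => μ
  have hcoord : ∀ i : Fin n, MemLp (fun x : Fin n → E => f (x i)) 2 P := fun i =>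
    hf.comp_measurePreserving (measurePreserving_eval (fun _ : Fin n => μ) i)
  have hsum : MemLp (∑ i, fun x : Fin n → E => f (x i)) 2 P :=
    memLp_finsetSum' _ fun i _ => hcoord i
  have hmean : P[∑ i, fun x : Fin n → E => f (x i)] = (n : ℝ) * μ[f] := by
    simp only [Finset.sum_apply]
    rw [integral_finsetSum _ fun i _ => (hcoord i).integrable (by norm_num)]
    have : ∀ i : Fin n, ∫ x, f (x i) ∂P = μ[f] := fun i => by
      have h := (measurePreserving_eval (fun _ : Fin n => μ) i)
      rw [← h.map_eq, integral_map h.measurable.aemeasurable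
        (by rw [h.map_eq]; exact hf.aestronglyMeasurable)]
    simp [this]
  have hvar : Var[∑ i, fun x : Fin n → E => f (x i); P] = n * Var[f; μ] := by
    rw [variance_sum_pi (X := fun _ => f) fun _ => hf]
    simp
  have hnδ : 0 < n * δ := by positivity
  have hsub : {x : Fin n → E | ∑ i, f (x i) < n * (μ[f] - δ)} ⊆
      {x | n * δ ≤ |(∑ i, fun x : Fin n → E => f (x i)) x
        - P[∑ i, fun x : Fin n → E => f (x i)]|} := by
    intro x hx
    simp only [Set.mem_ofPred_eq] at hx ⊢
    rw [hmean, Finset.sum_apply, abs_sub_comm]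
    refine le_trans ?_ (le_abs_self _)
    linarith
  refine (measure_mono hsub).trans ((meas_ge_le_variance_div_sq hsum hnδ).trans_eq ?_)
  rw [hvar]
  congr 1
  field_simp

end Tails

/-! ### Information densities -/

section InfoDensity

variable {k l m : ℕ}

/-- The logarithm of the ratio between the density of a row `y` of the measurement given all
coefficients `a`, and its density given the coefficients outside `T` only, when the signal has
rows `w`. Here `v` and `s` are the variances of the coefficients and of the noise. -/
noncomputable def infoDensity (v s : ℝ) (w : Fin k → Fin l → ℝ) (T : Finset (Fin k))
    (a : Fin k → ℝ) (y : Fin l → ℝ) : ℝ :=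
  logKernel s 1 (y - ∑ j, a j • w j) - logKernel s (gram (v / s) w T) (y - ∑ j ∈ Tᶜ, a j • w j)

lemma continuous_infoDensity (v s : ℝ) (w : Fin k → Fin l → ℝ) (T : Finset (Fin k)) :
    Continuous fun p : (Fin k → ℝ) × (Fin l → ℝ) => infoDensity v s w T p.1 p.2 := by
  unfold infoDensity
  fun_prop

/-- The joint law of the coefficients and the noise in one row of the measurement. -/
noncomputable def rowLaw (κ : Type*) [Fintype κ] (l : ℕ) (v s : ℝ) :
    Measure ((κ → ℝ) × (Fin l → ℝ)) :=
  (Measure.pi fun _ => gaussianReal 0 v.toNNReal).prod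
    (Measure.pi fun _ => gaussianReal 0 s.toNNReal)

instance {κ : Type*} [Fintype κ] {v s : ℝ} : IsProbabilityMeasure (rowLaw κ l v s) := by
  unfold rowLaw; infer_instance

/-- A row of the measurement. -/
def rowMeasurement (W : Fin k → Fin l → ℝ) (S : Fin k → Fin m)
    (p : (Fin m → ℝ) × (Fin l → ℝ)) : Fin l → ℝ :=
  ∑ j, p.1 (S j) • W j + p.2

@[fun_prop]
lemma continuous_rowMeasurement (W : Fin k → Fin l → ℝ) (S : Fin k → Fin m) :
    Continuous (rowMeasurement W S) := by
  unfold rowMeasurement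
  fun_prop

lemma continuous_infoDensity_rowMeasurement (v s : ℝ) (w W : Fin k → Fin l → ℝ)
    (T : Finset (Fin k)) (S S' : Fin k → Fin m) :
    Continuous fun p : (Fin m → ℝ) × (Fin l → ℝ) =>
      infoDensity v s w T (p.1 ∘ S') (rowMeasurement W S p) := by
  unfold infoDensity
  simp only [Function.comp_apply]
  fun_prop

/-- The exponential of the information density has mean at most one if the coefficients in `T`
are independent of the measurement and of the remaining coefficients. -/
lemma lintegral_exp_infoDensity_le_one {v s : ℝ} (hv : 0 < v) (hs : 0 < s)
    (w W : Fin k → Fin l → ℝ) (T : Finset (Fin k)) (S S' : Fin k → Fin m)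
    (hS' : Function.Injective S') (hT : ∀ j ∈ T, S' j ∉ Set.range S) :
    ∫⁻ p, ENNReal.ofReal (Real.exp (infoDensity v s w T (p.1 ∘ S') (rowMeasurement W S p)))
      ∂rowLaw (Fin m) l v s ≤ 1 := by
  have hmeas : Measurable fun p : (Fin m → ℝ) × (Fin l → ℝ) =>
      ENNReal.ofReal (Real.exp (infoDensity v s w T (p.1 ∘ S') (rowMeasurement W S p))) :=
    ENNReal.measurable_ofReal.comp (Real.measurable_exp.comp
      (continuous_infoDensity_rowMeasurement v s w W T S S').measurable)
  rw [rowLaw, lintegral_prod_symm _ hmeas.aemeasurable]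
  -- The noise plays no role in the cancellation: the bound holds for each fixed `z`.
  suffices h : ∀ z : Fin l → ℝ, ∫⁻ a, ENNReal.ofReal (Real.exp
      (infoDensity v s w T (a ∘ S') (rowMeasurement W S (a, z))))
      ∂(Measure.pi fun _ : Fin m => gaussianReal 0 v.toNNReal) ≤ 1 by
    refine (lintegral_mono h).trans ?_
    simp
  intro z
  set μ : Fin m → Measure ℝ := fun _ => gaussianReal 0 v.toNNReal
  set F : (Fin m → ℝ) → ℝ≥0∞ := fun a => ENNReal.ofReal (Real.exp
      (infoDensity v s w T (a ∘ S') (rowMeasurement W S (a, z)))) with hF_def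
  have hF : Measurable F := hmeas.comp measurable_prodMk_right
  set J : Finset (Fin m) := T.image S' with hJ
  -- Extension of `w` by zero to all of `Fin m`, so that the coefficients to be integrated out are
  -- indexed by coordinates of `a`.
  set c : Fin m → Fin l → ℝ := Function.extend S' w 0 with hc
  have hcS : ∀ j, c (S' j) = w j := fun j => hS'.extend_apply _ _ _
  -- What remains of the measurement after removing the candidate's rows outside `T`. It involves no
  -- coordinate in `J`, because `J` misses the true support and `S'` is injective.
  set u : (Fin m → ℝ) → Fin l → ℝ := fun a =>
    rowMeasurement W S (a, z) - ∑ j ∈ Tᶜ, a (S' j) • w j with hu_def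
  have hu : Measurable u := by
    refine Continuous.measurable ?_
    simp only [hu_def, rowMeasurement]
    fun_prop
  have huJ : ∀ a b : Fin m → ℝ, (∀ i ∉ J, a i = b i) → u a = u b := by
    intro a b hab
    have h1 : ∀ j, a (S j) = b (S j) := fun j => hab _ fun hj => by
      obtain ⟨j', hj', hjj⟩ := Finset.mem_image.1 hj
      exact hT j' hj' ⟨j, hjj.symm⟩
    have h2 : ∀ j ∈ Tᶜ, a (S' j) = b (S' j) := fun j hj => hab _ fun hj2 => by
      obtain ⟨j', hj', hjj⟩ := Finset.mem_image.1 hj2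
      exact Finset.mem_compl.1 hj (hS' hjj ▸ hj')
    simp only [hu_def, rowMeasurement, h1]
    congr 1
    exact Finset.sum_congr rfl fun j hj => by rw [h2 j hj]
  have hsum : ∀ a : Fin m → ℝ, ∑ i ∈ J, a i • c i = ∑ j ∈ T, a (S' j) • w j := fun a => by
    rw [hJ, Finset.sum_image hS'.injOn]
    simp only [hcS]
  have hgram : gram (v / s) c J = gram (v / s) w T := by
    rw [gram, gram, hJ, Finset.sum_image hS'.injOn]
    simp only [hcS]
  have hFeq : F = fun a => ENNReal.ofReal (Real.exp (logKernel s 1 (u a - ∑ i ∈ J, a i • c i))) *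
      ENNReal.ofReal (Real.exp (-logKernel s (gram (v / s) w T) (u a))) := by
    ext a
    rw [← ENNReal.ofReal_mul (Real.exp_pos _).le, ← Real.exp_add, hF_def]
    simp only [infoDensity, ← sub_eq_add_neg, hu_def, hsum, sub_sub, Function.comp_apply]
    rw [← Finset.sum_compl_add_sum T fun j => a (S' j) • w j]
  -- With the coordinates outside `J` fixed, the denominator is constant and the numerator
  -- integrates to it.
  have hmarg : ∫⋯∫⁻_J, F ∂μ ≤ ∫⋯∫⁻_J, (fun _ => 1) ∂μ := by
    intro x
    have hux : ∀ y : (J → ℝ), u (Function.updateFinset x J y) = u x := fun y =>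
      huJ _ _ fun i hi => by simp [Function.updateFinset, hi]
    have hker := lmarginal_exp_logKernel hv hs c J u hu (fun i hi x y =>
      huJ _ _ fun i' hi' => Function.update_of_ne (ne_of_mem_of_not_mem hi hi').symm _ _) x
    rw [hFeq]
    simp only [lmarginal, hux] at hker ⊢
    rw [lintegral_mul_const', hker, hgram, ← ENNReal.ofReal_mul (Real.exp_pos _).le,
      ← Real.exp_add]
    · simp
    · simp
  have := lmarginal_le_of_subset (Finset.subset_univ J) hF measurable_const hmarg
  have h0 := this 0
  simpa using h0

end InfoDensity

/-! ### Moments of the information density under the true model -/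

section Moments

lemma integral_eval_mul_eval_gaussian {κ : Type*} [Fintype κ] [DecidableEq κ] {v : ℝ} (hv : 0 ≤ v)
    (i j : κ) :
    ∫ x : κ → ℝ, x i * x j ∂(Measure.pi fun _ => gaussianReal 0 v.toNNReal) =
      if i = j then v else 0 := by
  have hmean : ∀ i : κ, ∫ x : κ → ℝ, x i ∂(Measure.pi fun _ => gaussianReal 0 v.toNNReal) = 0 :=
    fun i => by
      rw [integral_comp_eval (μ := fun _ : κ => gaussianReal 0 v.toNNReal) (i := i)
        (f := fun x : ℝ => x) (by fun_prop)]
      exact integral_id_gaussianReal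
  split_ifs with hij
  · subst hij
    rw [integral_comp_eval (μ := fun _ : κ => gaussianReal 0 v.toNNReal) (i := i)
        (f := fun x : ℝ => x * x) (by fun_prop)]
    have h := variance_fun_id_gaussianReal (μ := 0) (v := v.toNNReal)
    rw [variance_eq_integral (by fun_prop)] at h
    simpa [hv, sq] using h
  · have hind : iIndepFun (fun (i : κ) (x : κ → ℝ) => x i)
        (Measure.pi fun _ => gaussianReal 0 v.toNNReal) :=
      iIndepFun_pi (X := fun _ x => x) fun _ => aemeasurable_id
    rw [(hind.indepFun hij).integral_fun_mul_eq_mul_integral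
      (measurable_pi_apply i).aestronglyMeasurable (measurable_pi_apply j).aestronglyMeasurable,
      hmean, zero_mul]

variable {κ : Type*} [Fintype κ] {l : ℕ} {v s : ℝ}

lemma memLp_rowLaw_fst (i : κ) {p : ℝ≥0∞} (hp : p ≠ ∞) :
    MemLp (fun x : (κ → ℝ) × (Fin l → ℝ) => x.1 i) p (rowLaw κ l v s) := by
  have h := (memLp_id_gaussianReal' (μ := 0) (v := v.toNNReal) p hp).comp_measurePreserving
    (measurePreserving_eval (fun _ : κ => gaussianReal 0 v.toNNReal) i)
  exact h.comp_measurePreserving (measurePreserving_fst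
    (ν := Measure.pi fun _ : Fin l => gaussianReal 0 s.toNNReal))

lemma memLp_rowLaw_snd (i : Fin l) {p : ℝ≥0∞} (hp : p ≠ ∞) :
    MemLp (fun x : (κ → ℝ) × (Fin l → ℝ) => x.2 i) p (rowLaw κ l v s) := by
  have h := (memLp_id_gaussianReal' (μ := 0) (v := s.toNNReal) p hp).comp_measurePreserving
    (measurePreserving_eval (fun _ : Fin l => gaussianReal 0 s.toNNReal) i)
  exact h.comp_measurePreserving (measurePreserving_snd
    (μ := Measure.pi fun _ : κ => gaussianReal 0 v.toNNReal))

lemma memLp_rowLaw_comb (V : κ → Fin l → ℝ) (q : Fin l) {p : ℝ≥0∞} (hp : p ≠ ∞) :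
    MemLp (fun x : (κ → ℝ) × (Fin l → ℝ) => x.2 q + ∑ j, x.1 j * V j q) p (rowLaw κ l v s) :=
  (memLp_rowLaw_snd q hp).add
    (memLp_finsetSum _ fun j _ => (memLp_rowLaw_fst j hp).mul_const (V j q))

/-- The covariance of a residual "noise plus combination of coefficients"; cross terms vanish since
all variables are independent and centred. Means of `logKernel` depend on nothing else. -/
lemma integral_rowLaw_comb_mul_comb (hv : 0 ≤ v) (hs : 0 ≤ s) (V : κ → Fin l → ℝ)
    (q r : Fin l) :
    ∫ x : (κ → ℝ) × (Fin l → ℝ), (x.2 q + ∑ j, x.1 j * V j q) * (x.2 r + ∑ j, x.1 j * V j r)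
      ∂rowLaw κ l v s = (if q = r then s else 0) + v * ∑ j, V j q * V j r := by
  classical
  have h2 : ∀ q, MemLp (fun x : (κ → ℝ) × (Fin l → ℝ) => x.2 q) 2 (rowLaw κ l v s) :=
    fun q => memLp_rowLaw_snd q (by simp)
  have h1 : ∀ j, MemLp (fun x : (κ → ℝ) × (Fin l → ℝ) => x.1 j) 2 (rowLaw κ l v s) :=
    fun j => memLp_rowLaw_fst j (by simp)
  have i1 : Integrable (fun x : (κ → ℝ) × (Fin l → ℝ) => x.2 q * x.2 r) (rowLaw κ l v s) :=
    (h2 q).integrable_mul (h2 r)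
  have i2 : ∀ q r j, Integrable (fun x : (κ → ℝ) × (Fin l → ℝ) => V j r * (x.1 j * x.2 q))
      (rowLaw κ l v s) := fun q r j => ((h1 j).integrable_mul (h2 q)).const_mul _
  have i3 : ∀ i j, Integrable (fun x : (κ → ℝ) × (Fin l → ℝ) =>
      (V i q * V j r) * (x.1 i * x.1 j)) (rowLaw κ l v s) :=
    fun i j => ((h1 i).integrable_mul (h1 j)).const_mul _
  have e1 : ∫ x : (κ → ℝ) × (Fin l → ℝ), x.2 q * x.2 r ∂rowLaw κ l v s =
      if q = r then s else 0 := by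
    rw [rowLaw, integral_fun_snd (fun z : Fin l → ℝ => z q * z r),
      integral_eval_mul_eval_gaussian hs]
    simp
  have e2 : ∀ q j, ∫ x : (κ → ℝ) × (Fin l → ℝ), x.1 j * x.2 q ∂rowLaw κ l v s = 0 := by
    intro q j
    rw [rowLaw, integral_prod_mul (fun a : κ → ℝ => a j) (fun z : Fin l → ℝ => z q),
      integral_comp_eval (μ := fun _ : κ => gaussianReal 0 v.toNNReal) (i := j)
        (f := fun x : ℝ => x) (by fun_prop), integral_id_gaussianReal, zero_mul]
  have e3 : ∀ i j, ∫ x : (κ → ℝ) × (Fin l → ℝ), x.1 i * x.1 j ∂rowLaw κ l v s =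
      if i = j then v else 0 := by
    intro i j
    rw [rowLaw, integral_fun_fst (fun z : κ → ℝ => z i * z j),
      integral_eval_mul_eval_gaussian hv]
    simp
  have expand : ∀ x : (κ → ℝ) × (Fin l → ℝ),
      (x.2 q + ∑ j, x.1 j * V j q) * (x.2 r + ∑ j, x.1 j * V j r) =
      x.2 q * x.2 r + (∑ j, V j r * (x.1 j * x.2 q) + (∑ j, V j q * (x.1 j * x.2 r)
        + ∑ i, ∑ j, (V i q * V j r) * (x.1 i * x.1 j))) := by
    intro x
    rw [add_mul, mul_add, mul_add, Finset.sum_mul_sum, Finset.mul_sum, Finset.sum_mul, add_assoc]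
    congr 2
    · exact Finset.sum_congr rfl fun j _ => by ring
    · congr 1
      · exact Finset.sum_congr rfl fun j _ => by ring
      · exact Finset.sum_congr rfl fun i _ => Finset.sum_congr rfl fun j _ => by ring
  simp_rw [expand]
  have j2 : ∀ q r, Integrable (fun x : (κ → ℝ) × (Fin l → ℝ) => ∑ j, V j r * (x.1 j * x.2 q))
      (rowLaw κ l v s) := fun q r => integrable_finsetSum _ fun j _ => i2 q r j
  have j3 : Integrable (fun x : (κ → ℝ) × (Fin l → ℝ) =>
      ∑ i, ∑ j, (V i q * V j r) * (x.1 i * x.1 j)) (rowLaw κ l v s) :=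
    integrable_finsetSum _ fun i _ => integrable_finsetSum _ fun j _ => i3 i j
  have j4 : Integrable (fun x : (κ → ℝ) × (Fin l → ℝ) => ∑ j, V j q * (x.1 j * x.2 r) +
      ∑ i, ∑ j, (V i q * V j r) * (x.1 i * x.1 j)) (rowLaw κ l v s) := (j2 r q).add j3
  have j5 : Integrable (fun x : (κ → ℝ) × (Fin l → ℝ) => ∑ j, V j r * (x.1 j * x.2 q) +
      (∑ j, V j q * (x.1 j * x.2 r) + ∑ i, ∑ j, (V i q * V j r) * (x.1 i * x.1 j)))
      (rowLaw κ l v s) := (j2 q r).add j4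
  rw [integral_add i1 j5, integral_add (j2 q r) j4, integral_add (j2 r q) j3,
    integral_finsetSum _ fun j _ => i2 q r j, integral_finsetSum _ fun j _ => i2 r q j,
    integral_finsetSum _ fun i _ => integrable_finsetSum _ fun j _ => i3 i j]
  simp_rw [integral_finsetSum _ fun j _ => i3 _ j, integral_const_mul, e1, e2, e3]
  simp [Finset.mul_sum, mul_comm]

/-- The mean of `logKernel s M` at `z + ∑ j, a_j V_j` for independent centred Gaussian `a`, `z` with
coordinates of variance `v` and `s`. -/
noncomputable def meanLogKernel (v s : ℝ) (M : Matrix (Fin l) (Fin l) ℝ) (V : κ → Fin l → ℝ) : ℝ :=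
  -(Real.log M.det) / 2 -
    (∑ p, ∑ q, M⁻¹ p q * ((if p = q then s else 0) + v * ∑ j, V j p * V j q)) / (2 * s)

lemma logKernel_comb (M : Matrix (Fin l) (Fin l) ℝ) (V : κ → Fin l → ℝ)
    (x : (κ → ℝ) × (Fin l → ℝ)) :
    logKernel s M (x.2 + ∑ j, x.1 j • V j) = -(Real.log M.det) / 2 -
      (∑ p, ∑ q, M⁻¹ p q * ((x.2 p + ∑ j, x.1 j * V j p) * (x.2 q + ∑ j, x.1 j * V j q)))
        / (2 * s) := by
  simp only [logKernel, dotProduct, Matrix.mulVec, Pi.add_apply, Finset.sum_apply, Pi.smul_apply,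
    smul_eq_mul]
  congr 2
  refine Finset.sum_congr rfl fun p _ => ?_
  rw [Finset.mul_sum]
  exact Finset.sum_congr rfl fun q _ => by ring

lemma memLp_logKernel_comb (M : Matrix (Fin l) (Fin l) ℝ) (V : κ → Fin l → ℝ) :
    MemLp (fun x : (κ → ℝ) × (Fin l → ℝ) => logKernel s M (x.2 + ∑ j, x.1 j • V j)) 2
      (rowLaw κ l v s) := by
  simp_rw [logKernel_comb, div_eq_mul_inv _ (2 * s)]
  -- The kernel is quadratic in Gaussians: products of two `L⁴` functions lie in `L²`, as the
  -- variance bound requires.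
  have : ENNReal.HolderTriple 4 4 2 := ⟨by
    rw [show (4 : ℝ≥0∞) = 2 * 2 by norm_num, ENNReal.mul_inv (by simp) (by simp), ← mul_add,
      ENNReal.inv_two_add_inv_two, mul_one]⟩
  have hpq : ∀ p q, MemLp (fun x : (κ → ℝ) × (Fin l → ℝ) =>
      M⁻¹ p q * ((x.2 p + ∑ j, x.1 j * V j p) * (x.2 q + ∑ j, x.1 j * V j q))) 2
      (rowLaw κ l v s) := fun p q =>
    MemLp.const_mul ((memLp_rowLaw_comb V q (p := 4) (by simp)).mul'
      (memLp_rowLaw_comb V p (p := 4) (by simp))) _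
  have hsum : MemLp (fun x : (κ → ℝ) × (Fin l → ℝ) => ∑ p, ∑ q,
      M⁻¹ p q * ((x.2 p + ∑ j, x.1 j * V j p) * (x.2 q + ∑ j, x.1 j * V j q))) 2
      (rowLaw κ l v s) :=
    memLp_finsetSum _ fun p _ => memLp_finsetSum _ fun q _ => hpq p q
  exact (memLp_const _).sub (hsum.mul_const _)

lemma integral_logKernel_comb (hv : 0 ≤ v) (hs : 0 ≤ s) (M : Matrix (Fin l) (Fin l) ℝ)
    (V : κ → Fin l → ℝ) :
    ∫ x : (κ → ℝ) × (Fin l → ℝ), logKernel s M (x.2 + ∑ j, x.1 j • V j) ∂rowLaw κ l v s =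
      meanLogKernel v s M V := by
  simp_rw [logKernel_comb]
  have hint : ∀ p q, Integrable (fun x : (κ → ℝ) × (Fin l → ℝ) =>
      M⁻¹ p q * ((x.2 p + ∑ j, x.1 j * V j p) * (x.2 q + ∑ j, x.1 j * V j q)))
      (rowLaw κ l v s) := fun p q =>
    ((memLp_rowLaw_comb V p (p := 2) (by simp)).integrable_mul
      (memLp_rowLaw_comb V q (p := 2) (by simp))).const_mul _
  have hrow : ∀ p, Integrable (fun x : (κ → ℝ) × (Fin l → ℝ) =>
      ∑ q, M⁻¹ p q * ((x.2 p + ∑ j, x.1 j * V j p) * (x.2 q + ∑ j, x.1 j * V j q)))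
      (rowLaw κ l v s) := fun p => integrable_finsetSum _ fun q _ => hint p q
  have hsum : Integrable (fun x : (κ → ℝ) × (Fin l → ℝ) =>
      ∑ p, ∑ q, M⁻¹ p q * ((x.2 p + ∑ j, x.1 j * V j p) * (x.2 q + ∑ j, x.1 j * V j q)))
      (rowLaw κ l v s) := integrable_finsetSum _ fun p _ => hrow p
  rw [integral_sub (integrable_const _) (hsum.div_const _), integral_const, probReal_univ, one_smul,
    integral_div (2 * s), integral_finsetSum _ fun p _ => hrow p, meanLogKernel]
  congr 2
  refine Finset.sum_congr rfl fun p _ => ?_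
  rw [integral_finsetSum _ fun q _ => hint p q]
  refine Finset.sum_congr rfl fun q _ => ?_
  rw [integral_const_mul, integral_rowLaw_comb_mul_comb hv hs]

variable {k : ℕ}

/-- The mean of the information density of the candidate `w` when the signal has rows `W`. -/
noncomputable def meanInfoDensity (v s : ℝ) (W : Fin k → Fin l → ℝ) (T : Finset (Fin k))
    (w : Fin k → Fin l → ℝ) : ℝ :=
  meanLogKernel v s 1 (fun j => W j - w j) -
    meanLogKernel v s (gram (v / s) w T) (fun j => W j - if j ∈ T then 0 else w j)

lemma infoDensity_rowMeasurement_id (v s : ℝ) (w W : Fin k → Fin l → ℝ) (T : Finset (Fin k))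
    (x : (Fin k → ℝ) × (Fin l → ℝ)) :
    infoDensity v s w T x.1 (rowMeasurement W id x) =
      logKernel s 1 (x.2 + ∑ j, x.1 j • (W j - w j)) - logKernel s (gram (v / s) w T)
        (x.2 + ∑ j, x.1 j • (W j - if j ∈ T then 0 else w j)) := by
  have h : ∑ j ∈ Tᶜ, x.1 j • w j = ∑ j, x.1 j • (if j ∈ T then 0 else w j) := by
    rw [← Finset.sum_add_sum_compl T fun j => x.1 j • (if j ∈ T then 0 else w j),
      Finset.sum_eq_zero (s := T), zero_add]
    · exact Finset.sum_congr rfl fun j hj => by rw [if_neg (Finset.mem_compl.1 hj)]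
    · intro j hj; simp [hj]
  simp only [infoDensity, rowMeasurement, id, h, smul_sub, Finset.sum_sub_distrib]
  congr 2 <;> abel

lemma memLp_infoDensity (w W : Fin k → Fin l → ℝ) (T : Finset (Fin k)) :
    MemLp (fun x : (Fin k → ℝ) × (Fin l → ℝ) => infoDensity v s w T x.1 (rowMeasurement W id x)) 2
      (rowLaw (Fin k) l v s) := by
  simp_rw [infoDensity_rowMeasurement_id]
  exact (memLp_logKernel_comb _ _).sub (memLp_logKernel_comb _ _)

lemma integral_infoDensity (hv : 0 ≤ v) (hs : 0 ≤ s) (w W : Fin k → Fin l → ℝ)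
    (T : Finset (Fin k)) :
    ∫ x : (Fin k → ℝ) × (Fin l → ℝ), infoDensity v s w T x.1 (rowMeasurement W id x)
      ∂rowLaw (Fin k) l v s = meanInfoDensity v s W T w := by
  simp_rw [infoDensity_rowMeasurement_id]
  rw [integral_sub ((memLp_logKernel_comb _ _).integrable (by norm_num))
    ((memLp_logKernel_comb _ _).integrable (by norm_num)), integral_logKernel_comb hv hs,
    integral_logKernel_comb hv hs, meanInfoDensity]

/-- This allows `W` to be replaced by a nearby grid point. The determinant of `gram` never vanishes,
so its logarithm and the inverse matrix vary continuously. -/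
lemma continuous_meanInfoDensity (hv : 0 < v) (hs : 0 < s) (W : Fin k → Fin l → ℝ)
    (T : Finset (Fin k)) : Continuous (meanInfoDensity v s W T) := by
  have hg : Continuous fun w : Fin k → Fin l → ℝ => gram (v / s) w T := by
    refine continuous_matrix fun p q => ?_
    simp only [gram, Matrix.add_apply, Matrix.smul_apply, Matrix.sum_apply, Matrix.vecMulVec_apply]
    fun_prop
  have hdet : ∀ w : Fin k → Fin l → ℝ, (gram (v / s) w T).det ≠ 0 := fun w =>
    (posDef_gram (by positivity) w T).det_pos.ne'
  have hlog : Continuous fun w : Fin k → Fin l → ℝ => Real.log (gram (v / s) w T).det :=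
    hg.matrix_det.log hdet
  have hinv : ∀ p q, Continuous fun w : Fin k → Fin l → ℝ => (gram (v / s) w T)⁻¹ p q := by
    intro p q
    simp only [Matrix.inv_def, Ring.inverse_eq_inv', Matrix.smul_apply, smul_eq_mul]
    exact (hg.matrix_det.inv₀ hdet).mul (hg.matrix_adjugate.matrix_elem p q)
  have hite : ∀ j p, Continuous fun w : Fin k → Fin l → ℝ =>
      (W j - if j ∈ T then 0 else w j) p := by
    intro j p
    split_ifs <;> simp only [Pi.sub_apply] <;> fun_prop
  have hdiff : ∀ j p, Continuous fun w : Fin k → Fin l → ℝ => (W j - w j) p := by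
    intro j p
    simp only [Pi.sub_apply]
    fun_prop
  unfold meanInfoDensity meanLogKernel
  refine Continuous.sub (continuous_const.sub ?_) ((hlog.neg.div_const _).sub ?_)
  · refine Continuous.div_const (continuous_finsetSum _ fun p _ => continuous_finsetSum _
      fun q _ => continuous_const.mul (continuous_const.add (continuous_const.mul ?_))) _
    exact continuous_finsetSum _ fun j _ => (hdiff j p).mul (hdiff j q)
  · refine Continuous.div_const (continuous_finsetSum _ fun p _ => continuous_finsetSum _
      fun q _ => (hinv p q).mul (continuous_const.add (continuous_const.mul ?_))) _
    exact continuous_finsetSum _ fun j _ => (hite j p).mul (hite j q)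

/-- For the true rows the two residuals have covariances `s • 1` and `s • gram`, matching their
kernels. Each quadratic term then has mean `l / 2`; these cancel and only the log-determinant
survives. -/
lemma meanInfoDensity_self (hs : 0 < s) (hv : 0 < v) (W : Fin k → Fin l → ℝ)
    (T : Finset (Fin k)) :
    meanInfoDensity v s W T W = Real.log (gram (v / s) W T).det / 2 := by
  have hM := posDef_gram (r := v / s) (by positivity) W T
  have hdet : IsUnit (gram (v / s) W T).det := hM.det_pos.ne'.isUnit
  have hentry : ∀ p q, ((if p = q then s else 0) + v * ∑ j,
      (W j - if j ∈ T then 0 else W j) p * (W j - if j ∈ T then 0 else W j) q) =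
      s * gram (v / s) W T q p := by
    intro p q
    have h : ∑ j, (W j - if j ∈ T then 0 else W j) p * (W j - if j ∈ T then 0 else W j) q =
        ∑ j ∈ T, W j p * W j q := by
      rw [← Finset.sum_add_sum_compl T, Finset.sum_eq_zero (s := Tᶜ), add_zero]
      · exact Finset.sum_congr rfl fun j hj => by simp [hj]
      · intro j hj; simp [Finset.mem_compl.1 hj]
    rw [h]
    simp only [gram, Matrix.add_apply, Matrix.smul_apply, Matrix.sum_apply,
      Matrix.vecMulVec_apply, Matrix.one_apply, smul_eq_mul, eq_comm (a := q)]
    rw [Finset.sum_congr rfl fun j _ => mul_comm (W j q) (W j p)]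
    split_ifs
    · field_simp
    · field_simp
      ring
  have htrace : ∑ p, ∑ q, (gram (v / s) W T)⁻¹ p q * (s * gram (v / s) W T q p) = s * l := by
    have h1 : ∀ p, ∑ q, (gram (v / s) W T)⁻¹ p q * (s * gram (v / s) W T q p) = s := by
      intro p
      have := congrFun (congrFun (Matrix.nonsing_inv_mul _ hdet) p) p
      rw [Matrix.mul_apply, Matrix.one_apply_eq] at this
      calc _ = s * ∑ q, (gram (v / s) W T)⁻¹ p q * gram (v / s) W T q p := by
            rw [Finset.mul_sum]
            exact Finset.sum_congr rfl fun q _ => by ring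
        _ = s := by rw [this, mul_one]
    simp [h1, mul_comm]
  simp only [meanInfoDensity, meanLogKernel, hentry, htrace]
  simp [Matrix.one_apply, mul_comm]
  ring

attribute [irreducible] infoDensity

end Moments

/-! ### The decoder -/

section Decoder

variable {k l m n : ℕ}

/-- The candidate `(w, S')` explains the observation: for every nonempty set `T` of rows, the
information density exceeds the number of bits needed to locate the rows in `T`. -/
def Accepts (v s : ℝ) (w : Fin k → Fin l → ℝ) (S' : Fin k → Fin m)
    (A : Matrix (Fin n) (Fin m) ℝ) (Y : Matrix (Fin n) (Fin l) ℝ) : Prop :=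
  Function.Injective S' ∧ ∀ T : Finset (Fin k), T.Nonempty →
    T.card * Real.log m + √n ≤ ∑ i, infoDensity v s w T (fun j => A i (S' j)) (Y i)

/-- The decoder outputs all indices that occur in an accepted candidate, where the rows of the
candidates are taken from the first `n` entries of the sequence `grid`. -/
def decoder (v s : ℝ) (grid : ℕ → Fin k → Fin l → ℝ)
    (A : Matrix (Fin n) (Fin m) ℝ) (Y : Matrix (Fin n) (Fin l) ℝ) : Set (Fin m) :=
  {x | ∃ i : Fin n, ∃ S' : Fin k → Fin m, Accepts v s (grid i) S' A Y ∧ x ∈ Set.range S'}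

lemma measurableSet_accepts (v s : ℝ) (w : Fin k → Fin l → ℝ) (S' : Fin k → Fin m) :
    MeasurableSet {p : Matrix (Fin n) (Fin m) ℝ × Matrix (Fin n) (Fin l) ℝ |
      Accepts v s w S' p.1 p.2} := by
  have hmeas : ∀ (T : Finset (Fin k)) (i : Fin n), Measurable
      fun p : Matrix (Fin n) (Fin m) ℝ × Matrix (Fin n) (Fin l) ℝ =>
        infoDensity v s w T (fun j => p.1 i (S' j)) (p.2 i) := by
    intro T i
    have h1 : Measurable fun p : Matrix (Fin n) (Fin m) ℝ × Matrix (Fin n) (Fin l) ℝ =>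
        (fun j => p.1 i (S' j) : Fin k → ℝ) := measurable_pi_lambda _ fun j =>
      (measurable_pi_apply (S' j)).comp ((measurable_pi_apply i).comp measurable_fst)
    have h2 : Measurable fun p : Matrix (Fin n) (Fin m) ℝ × Matrix (Fin n) (Fin l) ℝ =>
        (p.2 i : Fin l → ℝ) := (measurable_pi_apply i).comp measurable_snd
    exact (continuous_infoDensity v s w T).measurable.comp (h1.prodMk h2)
  have hset : {p : Matrix (Fin n) (Fin m) ℝ × Matrix (Fin n) (Fin l) ℝ |
      Accepts v s w S' p.1 p.2} = {_p | Function.Injective S'} ∩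
      ⋂ T : Finset (Fin k), ⋂ _ : T.Nonempty, {p | T.card * Real.log m + √n ≤
        ∑ i, infoDensity v s w T (fun j => p.1 i (S' j)) (p.2 i)} := by
    ext p
    simp [Accepts]
  rw [hset]
  exact (MeasurableSet.const _).inter (MeasurableSet.iInter fun T => MeasurableSet.iInter fun _ =>
    measurableSet_le measurable_const (Finset.measurable_sum _ fun i _ => hmeas T i))

lemma measurable_decoder (v s : ℝ) (grid : ℕ → Fin k → Fin l → ℝ) :
    Measurable (Function.uncurry (decoder (m := m) (n := n) v s grid)) := by
  refine measurable_set_iff.2 fun x => measurableSet_setOfPred.1 ?_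
  have : {p : Matrix (Fin n) (Fin m) ℝ × Matrix (Fin n) (Fin l) ℝ |
      x ∈ Function.uncurry (decoder (m := m) (n := n) v s grid) p} =
      ⋃ i : Fin n, ⋃ S' : Fin k → Fin m,
        {p | Accepts v s (grid i) S' p.1 p.2} ∩ {_p | x ∈ Set.range S'} := by
    ext p
    simp [decoder, Function.uncurry]
  rw [this]
  exact MeasurableSet.iUnion fun i => MeasurableSet.iUnion fun S' =>
    (measurableSet_accepts v s (grid i) S').inter (MeasurableSet.const _)

/-! ### Deterministic facts about the model -/

lemma rowSupport_signal (hl : 0 < l) {W : Matrix (Fin k) (Fin l) ℝ} (hW : ∀ i j, W i j ≠ 0)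
    {S : Fin k → Fin m} (hS : Function.Injective S) :
    rowSupport (signal W S) = Set.range S := by
  ext x
  simp only [rowSupport, signal, Set.mem_ofPred_eq, Matrix.of_apply, Set.mem_range]
  constructor
  · rintro ⟨i, hi⟩
    obtain ⟨j, -, hj⟩ := Finset.exists_ne_zero_of_sum_ne_zero hi
    exact ⟨j, by by_contra h; exact hj (if_neg fun h' => h h'.symm)⟩
  · rintro ⟨j, rfl⟩
    refine ⟨⟨0, hl⟩, ?_⟩
    simpa [hS.eq_iff] using hW j ⟨0, hl⟩

lemma mul_signal_add_apply (W : Matrix (Fin k) (Fin l) ℝ) (S : Fin k → Fin m)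
    (A : Matrix (Fin n) (Fin m) ℝ) (Z : Matrix (Fin n) (Fin l) ℝ) (i : Fin n) :
    (A * signal W S + Z) i = rowMeasurement W S (A i, Z i) := by
  ext q
  simp only [Matrix.add_apply, Matrix.mul_apply, signal, Matrix.of_apply, rowMeasurement,
    Pi.add_apply, Finset.sum_apply, Pi.smul_apply, smul_eq_mul, Finset.mul_sum]
  rw [Finset.sum_comm]
  simp

/-- Positions in `T` are free, the others have at most `k` values each. The factor `m ^ T.card` is
what the term `|T| log m` in the test pays for. -/
lemma card_filter_mem_range_le (hk : 0 < k) (S : Fin k → Fin m) (T : Finset (Fin k)) :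
    (Fintype.piFinset fun j => if j ∈ T then Finset.univ else Finset.univ.image S).card ≤
      k ^ k * m ^ T.card := by
  rw [Fintype.card_piFinset]
  calc ∏ j, (if j ∈ T then (Finset.univ : Finset (Fin m)) else Finset.univ.image S).card
      ≤ ∏ j, (k * if j ∈ T then m else 1) := by
        refine Finset.prod_le_prod' fun j _ => ?_
        split_ifs
        · simpa using Nat.le_mul_of_pos_left m hk
        · simpa using Finset.card_image_le (s := Finset.univ) (f := S)
    _ = k ^ k * m ^ T.card := by
        rw [Finset.prod_mul_distrib, Finset.prod_ite_mem]
        simp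

/-! ### The error probability for fixed locations -/

/-- The test of the true locations sees only `k` of the `m` coefficients, so its law depends neither
on `m` nor on `S`. -/
lemma measurePreserving_comp_injective {α : Type*} [MeasurableSpace α] {κ κ' : Type*} [Fintype κ]
    [Fintype κ'] (μ : Measure α) [IsProbabilityMeasure μ] {S : κ → κ'}
    (hS : Function.Injective S) :
    MeasurePreserving (fun a : κ' → α => a ∘ S) (Measure.pi fun _ => μ)
      (Measure.pi fun _ => μ) := by
  have hm : ∀ j : κ, Measurable fun a : κ' → α => a (S j) := fun j => measurable_pi_apply _
  refine ⟨measurable_pi_lambda _ hm, ?_⟩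
  have hind : iIndepFun (fun (i : κ') (a : κ' → α) => a i) (Measure.pi fun _ => μ) :=
    iIndepFun_pi (X := fun _ x => x) fun _ => aemeasurable_id
  have h := (iIndepFun_iff_map_fun_eq_pi_map fun j => (hm j).aemeasurable).1 (hind.precomp hS)
  refine h.trans ?_
  congr 1
  ext1 j
  exact (measurePreserving_eval (fun _ : κ' => μ) (S j)).map_eq

lemma pi_measure_sum_infoDensity_lt_le {v s : ℝ} (hv : 0 ≤ v) (hs : 0 ≤ s)
    (w W : Fin k → Fin l → ℝ) (T : Finset (Fin k)) {S : Fin k → Fin m}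
    (hS : Function.Injective S) (hn : 0 < n) {δ : ℝ} (hδ : 0 < δ) :
    (Measure.pi fun _ : Fin n => rowLaw (Fin m) l v s)
      {x | ∑ i, infoDensity v s w T ((x i).1 ∘ S) (rowMeasurement W S (x i)) <
        n * (meanInfoDensity v s W T w - δ)} ≤
      ENNReal.ofReal (Var[fun x => infoDensity v s w T x.1 (rowMeasurement W id x);
        rowLaw (Fin k) l v s] / (n * δ ^ 2)) := by
  set f : (Fin k → ℝ) × (Fin l → ℝ) → ℝ :=
    fun x => infoDensity v s w T x.1 (rowMeasurement W id x)
  have hf : MemLp f 2 (rowLaw (Fin k) l v s) := memLp_infoDensity w W T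
  have hφ : MeasurePreserving (Prod.map (fun a : Fin m → ℝ => a ∘ S) (id : (Fin l → ℝ) → _))
      (rowLaw (Fin m) l v s) (rowLaw (Fin k) l v s) :=
    (measurePreserving_comp_injective (gaussianReal 0 v.toNNReal) hS).prod (MeasurePreserving.id _)
  have hf' : AEStronglyMeasurable f
      ((rowLaw (Fin m) l v s).map (Prod.map (fun a : Fin m → ℝ => a ∘ S) id)) := by
    rw [hφ.map_eq]; exact hf.aestronglyMeasurable
  have h := pi_measure_sum_lt_le_variance (hf.comp_measurePreserving hφ) hn hδ
  have hmean : ∫ x, (f ∘ Prod.map (fun a : Fin m → ℝ => a ∘ S) id) x ∂rowLaw (Fin m) l v s =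
      meanInfoDensity v s W T w := by
    rw [← integral_infoDensity hv hs w W T, ← hφ.map_eq,
      integral_map hφ.measurable.aemeasurable hf']
    rfl
  have hvar : Var[f ∘ Prod.map (fun a : Fin m → ℝ => a ∘ S) id; rowLaw (Fin m) l v s] =
      Var[f; rowLaw (Fin k) l v s] := by
    rw [← hφ.map_eq, variance_map hf'.aemeasurable hφ.measurable.aemeasurable]
  rw [hmean, hvar] at h
  exact h

lemma sum_pi_measure_le_sum_infoDensity_le {v s : ℝ} (hv : 0 < v) (hs : 0 < s) (hk : 0 < k)
    (hm : 0 < m) (w W : Fin k → Fin l → ℝ) (T : Finset (Fin k)) (S : Fin k → Fin m) (t : ℝ) :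
    ∑ S' ∈ (Fintype.piFinset fun j => if j ∈ T then Finset.univ else Finset.univ.image S) with
      Function.Injective S' ∧ ∀ j ∈ T, S' j ∉ Set.range S,
      (Measure.pi fun _ : Fin n => rowLaw (Fin m) l v s)
        {x | T.card * Real.log m + t ≤
          ∑ i, infoDensity v s w T ((x i).1 ∘ S') (rowMeasurement W S (x i))} ≤
      ENNReal.ofReal (k ^ k * Real.exp (-t)) := by
  refine (Finset.sum_le_card_nsmul _ _ (ENNReal.ofReal (Real.exp (-(T.card * Real.log m + t))))
    fun S' hS' => ?_).trans ?_
  · obtain ⟨-, hinj, hT⟩ := Finset.mem_filter.1 hS'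
    exact pi_measure_le_sum_le_exp
      (f := fun p => infoDensity v s w T (p.1 ∘ S') (rowMeasurement W S p))
      (continuous_infoDensity_rowMeasurement v s w W T S S').measurable
      (lintegral_exp_infoDensity_le_one hv hs w W T S S' hinj hT) n _
  · rw [nsmul_eq_mul, ← ENNReal.ofReal_natCast, ← ENNReal.ofReal_mul (Nat.cast_nonneg _)]
    refine ENNReal.ofReal_le_ofReal ?_
    have hcard := (Finset.card_filter_le _ fun S' : Fin k → Fin m =>
      Function.Injective S' ∧ ∀ j ∈ T, S' j ∉ Set.range S).trans (card_filter_mem_range_le hk S T)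
    have hm' : (0 : ℝ) < m := Nat.cast_pos.2 hm
    have hexp : Real.exp (-(T.card * Real.log m + t)) = ((m : ℝ) ^ T.card)⁻¹ * Real.exp (-t) := by
      rw [neg_add, Real.exp_add, Real.exp_neg, Real.exp_nat_mul, Real.exp_log hm']
    rw [hexp]
    calc _ ≤ ((k ^ k * m ^ T.card : ℕ) : ℝ) * (((m : ℝ) ^ T.card)⁻¹ * Real.exp (-t)) := by
          gcongr
      _ = k ^ k * Real.exp (-t) := by
          push_cast
          field_simp

/-- A wrong answer of the decoder is caused by rejecting the true locations or by accepting some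
wrong locations. -/
lemma setOf_decoder_ne_subset (v s : ℝ) (grid : ℕ → Fin k → Fin l → ℝ)
    (W : Matrix (Fin k) (Fin l) ℝ) {S : Fin k → Fin m} (hS : Function.Injective S) (i₀ : Fin n) :
    {x : Fin n → (Fin m → ℝ) × (Fin l → ℝ) |
      decoder v s grid (fun i => (x i).1 : Matrix (Fin n) (Fin m) ℝ)
        (fun i => rowMeasurement W S (x i)) ≠ Set.range S} ⊆
    (⋃ T ∈ ({T | T.Nonempty} : Finset (Finset (Fin k))),
      {x | ∑ i, infoDensity v s (grid i₀) T ((x i).1 ∘ S) (rowMeasurement W S (x i)) <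
        T.card * Real.log m + √n}) ∪
    ⋃ j ∈ (Finset.univ : Finset (Fin n)), ⋃ T ∈ (Finset.univ : Finset (Finset (Fin k))),
      ⋃ S' ∈ ({S' ∈ (Fintype.piFinset fun j =>
          if j ∈ T then Finset.univ else Finset.univ.image S) |
        Function.Injective S' ∧ ∀ j ∈ T, S' j ∉ Set.range S} : Finset (Fin k → Fin m)),
      {x | T.card * Real.log m + √n ≤
        ∑ i, infoDensity v s (grid j) T ((x i).1 ∘ S') (rowMeasurement W S (x i))} := by
  intro x hx
  by_contra hcon
  simp only [Set.mem_union, not_or, Set.mem_iUnion, not_exists] at hcon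
  obtain ⟨h1, h2⟩ := hcon
  refine hx (Set.Subset.antisymm ?_ ?_)
  · rintro y ⟨j, S', ⟨hinj, hacc⟩, hy⟩
    -- For the set of misplaced rows, acceptance of a wrong candidate is one of the events in the
    -- second union; hence no row is misplaced.
    set T : Finset (Fin k) := {j | S' j ∉ Set.range S} with hT
    have hTe : T = ∅ := by
      by_contra hne
      refine h2 j (Finset.mem_univ _) T (Finset.mem_univ _) S' ?_
        (hacc T (Finset.nonempty_iff_ne_empty.2 hne))
      refine Finset.mem_filter.2 ⟨Fintype.mem_piFinset.2 fun j => ?_, hinj,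
        fun j hj => (Finset.mem_filter.1 hj).2⟩
      split_ifs with hj
      · exact Finset.mem_univ _
      · have : S' j ∈ Set.range S := by
          by_contra h
          exact hj (Finset.mem_filter.2 ⟨Finset.mem_univ _, h⟩)
        obtain ⟨j', hj'⟩ := this
        exact Finset.mem_image.2 ⟨j', Finset.mem_univ _, hj'⟩
    obtain ⟨j', rfl⟩ := hy
    by_contra h
    have : j' ∈ T := Finset.mem_filter.2 ⟨Finset.mem_univ _, h⟩
    simp [hTe] at this
  · intro y hy
    refine ⟨i₀, S, ⟨hS, fun T hT => ?_⟩, hy⟩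
    exact not_lt.1 (h1 T (Finset.mem_filter.2 ⟨Finset.mem_univ _, hT⟩))

/-- The bound for the probability of error, for every fixed choice of locations. -/
noncomputable def errorBound (v s : ℝ) (w W : Fin k → Fin l → ℝ) (δ : Finset (Fin k) → ℝ)
    (n : ℕ) : ℝ :=
  ∑ T : Finset (Fin k) with T.Nonempty,
    Var[fun x => infoDensity v s w T x.1 (rowMeasurement W id x); rowLaw (Fin k) l v s] /
      (n * δ T ^ 2) +
  n * (2 ^ k * (k ^ k * Real.exp (-√n)))

lemma prod_gaussianMatrix_decoder_ne_le (hk : 0 < k) (hl : 0 < l) {σa σz : ℝ} (hσa : 0 < σa)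
    (hσz : 0 < σz) (grid : ℕ → Fin k → Fin l → ℝ) {W : Matrix (Fin k) (Fin l) ℝ}
    (hW : ∀ i j, W i j ≠ 0) {S : Fin k → Fin m} (hS : Function.Injective S) {i₀ : ℕ}
    (hi₀ : i₀ < n) {δ : Finset (Fin k) → ℝ} (hδ : ∀ T, T.Nonempty → 0 < δ T)
    (hτ : ∀ T : Finset (Fin k), T.Nonempty → T.card * Real.log m + √n ≤
      n * (meanInfoDensity (σa ^ 2) (σz ^ 2) W T (grid i₀) - δ T)) :
    ((gaussianMatrix n m σa).prod (gaussianMatrix n l σz))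
      {p | decoder (σa ^ 2) (σz ^ 2) grid p.1 (p.1 * signal W S + p.2) ≠
        rowSupport (signal W S)} ≤
      ENNReal.ofReal (errorBound (σa ^ 2) (σz ^ 2) (grid i₀) W δ n) := by
  have hv : 0 < σa ^ 2 := by positivity
  have hs : 0 < σz ^ 2 := by positivity
  have hn : 0 < n := i₀.zero_le.trans_lt hi₀
  have hm : 0 < m := (S ⟨0, hk⟩).pos
  rw [rowSupport_signal hl hW hS]
  -- The pair `(A, Z)` is regrouped as `n` independent rows, each with law `rowLaw`.
  have he := measurePreserving_arrowProdEquivProdArrow (Fin m → ℝ) (Fin l → ℝ) (Fin n)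
    (fun _ => Measure.pi fun _ => gaussianReal 0 (σa ^ 2).toNNReal)
    (fun _ => Measure.pi fun _ => gaussianReal 0 (σz ^ 2).toNNReal)
  have hpre := he.measure_preimage_equiv
    {p : Matrix (Fin n) (Fin m) ℝ × Matrix (Fin n) (Fin l) ℝ |
      decoder (σa ^ 2) (σz ^ 2) grid p.1 (p.1 * signal W S + p.2) ≠ Set.range S}
  refine hpre.symm.trans_le ?_
  have hset : (MeasurableEquiv.arrowProdEquivProdArrow (Fin m → ℝ) (Fin l → ℝ) (Fin n)) ⁻¹'
      {p : Matrix (Fin n) (Fin m) ℝ × Matrix (Fin n) (Fin l) ℝ |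
        decoder (σa ^ 2) (σz ^ 2) grid p.1 (p.1 * signal W S + p.2) ≠ Set.range S} =
      {x : Fin n → (Fin m → ℝ) × (Fin l → ℝ) |
        decoder (σa ^ 2) (σz ^ 2) grid (fun i => (x i).1 : Matrix (Fin n) (Fin m) ℝ)
          (fun i => rowMeasurement W S (x i)) ≠ Set.range S} := by
    ext x
    have hY : (Matrix.of fun i => (x i).1) * signal W S + (Matrix.of fun i => (x i).2) = fun i => rowMeasurement W S (x i) :=
      funext fun i => mul_signal_add_apply W S _ _ i
    rw [Set.mem_ofPred_eq, ← hY]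
    rfl
  rw [hset]
  refine (measure_mono (setOf_decoder_ne_subset (σa ^ 2) (σz ^ 2) grid W hS ⟨i₀, hi₀⟩)).trans ?_
  refine (measure_union_le _ _).trans ?_
  unfold errorBound
  rw [ENNReal.ofReal_add (Finset.sum_nonneg fun T _ =>
    div_nonneg (variance_nonneg _ _) (by positivity)) (by positivity)]
  refine add_le_add ?_ ?_
  · refine (measure_biUnion_finset_le _ _).trans ?_
    rw [ENNReal.ofReal_sum_of_nonneg fun T _ => div_nonneg (variance_nonneg _ _) (by positivity)]
    refine Finset.sum_le_sum fun T hT => ?_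
    have hT' : T.Nonempty := (Finset.mem_filter.1 hT).2
    exact (measure_mono fun x hx => lt_of_lt_of_le hx (hτ T hT')).trans
      (pi_measure_sum_infoDensity_lt_le hv.le hs.le (grid i₀) W T hS hn (hδ T hT'))
  · refine (measure_biUnion_finset_le _ _).trans ?_
    rw [ENNReal.ofReal_mul (Nat.cast_nonneg n), ENNReal.ofReal_natCast]
    refine (Finset.sum_le_card_nsmul _ _
      (ENNReal.ofReal (2 ^ k * (k ^ k * Real.exp (-√n)))) fun j _ => ?_).trans (by simp)
    refine (measure_biUnion_finset_le _ _).trans ?_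
    refine (Finset.sum_le_card_nsmul _ _ (ENNReal.ofReal (k ^ k * Real.exp (-√n)))
      fun T _ => ?_).trans ?_
    · exact (measure_biUnion_finset_le _ _).trans
        (sum_pi_measure_le_sum_infoDensity_le hv hs hk hm (grid j) W T S √n)
    · rw [ENNReal.ofReal_mul (by positivity) (p := 2 ^ k), nsmul_eq_mul]
      simp [ENNReal.ofReal_pow]

end Decoder

/-! ### Averaging over the locations and asymptotics -/

section Asymptotics

variable {k l m n : ℕ}

/-- The locations are discrete, so the product splits into finitely many slices and `B` need not be
measurable. For `m < k` the location law is zero, hence only total mass at most one is used. -/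
lemma locationLaw_prod_le {Ω : Type*} [MeasurableSpace Ω] (P : Measure Ω) [SFinite P]
    (B : Set ((Fin k → Fin m) × Ω)) (b : ℝ≥0∞)
    (hB : ∀ S : Fin k → Fin m, Function.Injective S → P {ω | (S, ω) ∈ B} ≤ b) :
    (locationLaw k m).prod P B ≤ b := by
  have hsub : B ⊆ ⋃ S ∈ (Finset.univ : Finset (Fin k → Fin m)), {S} ×ˢ {ω | (S, ω) ∈ B} := by
    rintro ⟨S, ω⟩ h
    simpa using h
  have hzero : ∀ S : Fin k → Fin m, ¬ Function.Injective S → locationLaw k m {S} = 0 := by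
    intro S hS
    rw [locationLaw, uniformOn, cond_apply (Set.toFinite _).measurableSet,
      Set.inter_singleton_eq_empty.2 (by simpa using hS)]
    simp
  have : IsFiniteMeasure (locationLaw k m) := by unfold locationLaw uniformOn; infer_instance
  have hone : locationLaw k m Set.univ ≤ 1 := by
    unfold locationLaw uniformOn
    exact prob_le_one
  calc (locationLaw k m).prod P B
      ≤ ∑ S, (locationLaw k m).prod P ({S} ×ˢ {ω | (S, ω) ∈ B}) :=
        (measure_mono hsub).trans (measure_biUnion_finset_le _ _)
    _ ≤ ∑ S, locationLaw k m {S} * b := by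
        refine Finset.sum_le_sum fun S _ => ?_
        rw [Measure.prod_prod]
        by_cases hS : Function.Injective S
        · gcongr
          exact hB S hS
        · simp [hzero S hS]
    _ = locationLaw k m Set.univ * b := by
        rw [← Finset.sum_mul, ← Finset.coe_univ, sum_measure_singleton]
    _ ≤ b := mul_le_of_le_one_left' hone

instance (p q : ℕ) (σ : ℝ) : IsProbabilityMeasure (gaussianMatrix p q σ) := by
  unfold gaussianMatrix
  exact inferInstanceAs (IsProbabilityMeasure (Measure.pi fun _ : Fin p =>
    Measure.pi fun _ : Fin q => gaussianReal 0 (σ ^ 2).toNNReal))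

lemma errorBound_nonneg (v s : ℝ) (w W : Fin k → Fin l → ℝ) (δ : Finset (Fin k) → ℝ) (n : ℕ) :
    0 ≤ errorBound v s w W δ n := by
  unfold errorBound
  exact add_nonneg (Finset.sum_nonneg fun T _ =>
    div_nonneg (variance_nonneg _ _) (by positivity)) (by positivity)

lemma errorProb_decoder_le (hk : 0 < k) (hl : 0 < l) {σa σz : ℝ} (hσa : 0 < σa)
    (hσz : 0 < σz) (grid : ℕ → Fin k → Fin l → ℝ) {W : Matrix (Fin k) (Fin l) ℝ}
    (hW : ∀ i j, W i j ≠ 0) {i₀ : ℕ}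
    (hi₀ : i₀ < n) {δ : Finset (Fin k) → ℝ} (hδ : ∀ T, T.Nonempty → 0 < δ T)
    (hτ : ∀ T : Finset (Fin k), T.Nonempty → T.card * Real.log m + √n ≤
      n * (meanInfoDensity (σa ^ 2) (σz ^ 2) W T (grid i₀) - δ T)) :
    errorProb (m := m) (n := n) σa σz W (decoder (σa ^ 2) (σz ^ 2) grid) ≤
      errorBound (σa ^ 2) (σz ^ 2) (grid i₀) W δ n := by
  refine ENNReal.toReal_le_of_le_ofReal (errorBound_nonneg _ _ _ _ _ _) ?_
  refine locationLaw_prod_le _ _ _ fun S hS => ?_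
  exact prod_gaussianMatrix_decoder_ne_le hk hl hσa hσz grid hW hS hi₀ hδ hτ

lemma tendsto_errorBound (v s : ℝ) (w W : Fin k → Fin l → ℝ) (δ : Finset (Fin k) → ℝ) :
    Tendsto (errorBound v s w W δ) atTop (𝓝 0) := by
  have h1 : Tendsto (fun n : ℕ => ∑ T : Finset (Fin k) with T.Nonempty,
      Var[fun x => infoDensity v s w T x.1 (rowMeasurement W id x); rowLaw (Fin k) l v s] /
        (n * δ T ^ 2)) atTop (𝓝 0) := by
    rw [← Finset.sum_const_zero (s := ({T | T.Nonempty} : Finset (Finset (Fin k))))]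
    refine tendsto_finsetSum _ fun T _ => ?_
    have := (tendsto_const_div_atTop_nhds_zero_nat
      (Var[fun x => infoDensity v s w T x.1 (rowMeasurement W id x); rowLaw (Fin k) l v s] /
        δ T ^ 2))
    refine this.congr fun n => ?_
    rw [div_div, mul_comm]
  have h2 : Tendsto (fun n : ℕ => (n : ℝ) * (2 ^ k * (k ^ k * Real.exp (-√n)))) atTop (𝓝 0) := by
    -- With `x = √n` the term is a constant times `x² exp(-x)`.
    have := ((Real.tendsto_pow_mul_exp_neg_atTop_nhds_zero 2).comp
      (Real.tendsto_sqrt_atTop.comp tendsto_natCast_atTop_atTop)).const_mul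
      ((2 : ℝ) ^ k * k ^ k)
    rw [mul_zero] at this
    refine this.congr fun n => ?_
    simp only [Function.comp_apply, Real.sq_sqrt (Nat.cast_nonneg n)]
    ring
  have h := h1.add h2
  rw [add_zero] at h
  exact h

lemma gram_eq_one_add_smul_submatrix (r : ℝ) (W : Matrix (Fin k) (Fin l) ℝ)
    (T : Finset (Fin k)) :
    gram r W T = 1 + r • ((W.submatrix (fun i : T => (i : Fin k)) id).transpose *
      W.submatrix (fun i : T => (i : Fin k)) id) := by
  unfold gram
  congr 2
  ext p q
  rw [Matrix.sum_apply, Matrix.mul_apply, ← Finset.sum_coe_sort]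
  rfl

lemma card_mul_threshold_le {σa σz : ℝ} (W : Matrix (Fin k) (Fin l) ℝ) {T : Finset (Fin k)}
    (hT : T.Nonempty) :
    T.card * threshold σa σz W ≤ Real.log (gram (σa ^ 2 / σz ^ 2) W T).det / 2 := by
  have hcard : (0 : ℝ) < T.card := Nat.cast_pos.2 hT.card_pos
  have h : threshold σa σz W ≤
      1 / (2 * (T.card : ℝ)) * Real.log (gram (σa ^ 2 / σz ^ 2) W T).det := by
    rw [gram_eq_one_add_smul_submatrix]
    exact ciInf_le (Set.finite_range _).bddBelow (⟨T, hT⟩ : {T : Finset (Fin k) // T.Nonempty})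
  calc T.card * threshold σa σz W
      ≤ T.card * (1 / (2 * (T.card : ℝ)) * Real.log (gram (σa ^ 2 / σz ^ 2) W T).det) := by gcongr
    _ = _ := by field_simp

/-- The candidate rows close to `W` have mean information densities above the rate. -/
lemma exists_grid_meanInfoDensity_gt {σa σz : ℝ} (hσa : 0 < σa) (hσz : 0 < σz)
    {grid : ℕ → Fin k → Fin l → ℝ} (hgrid : DenseRange grid) (W : Matrix (Fin k) (Fin l) ℝ)
    {R : ℝ} (hR : R < threshold σa σz W) :
    ∃ i₀, ∀ T : Finset (Fin k), T.Nonempty →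
      T.card * R < meanInfoDensity (σa ^ 2) (σz ^ 2) W T (grid i₀) := by
  have hv : 0 < σa ^ 2 := by positivity
  have hs : 0 < σz ^ 2 := by positivity
  have hopen : IsOpen {w : Fin k → Fin l → ℝ | ∀ T : Finset (Fin k), T.Nonempty →
      T.card * R < meanInfoDensity (σa ^ 2) (σz ^ 2) W T w} := by
    have hset : {w : Fin k → Fin l → ℝ | ∀ T : Finset (Fin k), T.Nonempty →
        T.card * R < meanInfoDensity (σa ^ 2) (σz ^ 2) W T w} =
        ⋂ T : Finset (Fin k), ⋂ _ : T.Nonempty,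
          {w | T.card * R < meanInfoDensity (σa ^ 2) (σz ^ 2) W T w} := by
      ext w
      simp
    rw [hset]
    exact isOpen_iInter_of_finite fun T => isOpen_iInter_of_finite fun _ =>
      isOpen_lt continuous_const (continuous_meanInfoDensity hv hs W T)
  refine hgrid.exists_mem_open hopen ⟨W, fun T hT => ?_⟩
  refine lt_of_lt_of_le ?_ ((card_mul_threshold_le W hT).trans_eq
    (meanInfoDensity_self hs hv W T).symm)
  have : (0 : ℝ) < T.card := Nat.cast_pos.2 hT.card_pos
  gcongr

lemma tendsto_errorProb_decoder (hk : 0 < k) (hl : 0 < l) {σa σz : ℝ} (hσa : 0 < σa)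
    (hσz : 0 < σz) {grid : ℕ → Fin k → Fin l → ℝ} (hgrid : DenseRange grid) {n : ℕ → ℕ}
    (hn : ∀ m, k ≤ m → 0 < n m) {W : Matrix (Fin k) (Fin l) ℝ} (hW : ∀ i j, W i j ≠ 0)
    (hrate : limsup (fun m : ℕ => ((Real.log m / n m : ℝ) : EReal)) atTop
      < (threshold σa σz W : EReal)) :
    Tendsto (fun m => errorProb (m := m) (n := n m) σa σz W (decoder (σa ^ 2) (σz ^ 2) grid))
      atTop (𝓝 0) := by
  obtain ⟨R, hR1, hR2⟩ := EReal.lt_iff_exists_real_btwn.1 hrate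
  have hR2' : R < threshold σa σz W := EReal.coe_lt_coe_iff.1 hR2
  have hlog : ∀ᶠ m : ℕ in atTop, Real.log m ≤ R * n m := by
    filter_upwards [eventually_lt_of_limsup_lt hR1, eventually_ge_atTop k] with m hm hkm
    have h := EReal.coe_lt_coe_iff.1 hm
    rw [div_lt_iff₀ (Nat.cast_pos.2 (hn m hkm))] at h
    exact h.le
  have hlogtop : Tendsto (fun m : ℕ => Real.log m) atTop atTop :=
    Real.tendsto_log_atTop.comp tendsto_natCast_atTop_atTop
  -- Since `log m ≤ R n` eventually and `log m → ∞`, the number `R` is positive and `n ≥ log m / R`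
  -- tends to infinity.
  have hRpos : 0 < R := by
    obtain ⟨m, h1, h2⟩ := (hlog.and (hlogtop.eventually_gt_atTop 0)).exists
    by_contra! h
    exact absurd (h2.trans_le h1) (not_lt.2 (mul_nonpos_of_nonpos_of_nonneg h (Nat.cast_nonneg _)))
  have hntop : Tendsto n atTop atTop := by
    rw [← tendsto_natCast_atTop_iff (R := ℝ)]
    refine tendsto_atTop_mono' _ ?_ (hlogtop.atTop_div_const hRpos)
    filter_upwards [hlog] with m hm
    rwa [div_le_iff₀' hRpos]
  obtain ⟨i₀, hi₀⟩ := exists_grid_meanInfoDensity_gt hσa hσz hgrid W hR2'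
  -- Half of the gap between the mean and `|T| R`: one half is the Chebyshev deviation, the other
  -- absorbs `√n`.
  set δ : Finset (Fin k) → ℝ := fun T =>
    (meanInfoDensity (σa ^ 2) (σz ^ 2) W T (grid i₀) - T.card * R) / 2 with hδ_def
  have hδ : ∀ T, T.Nonempty → 0 < δ T := fun T hT => half_pos (sub_pos.2 (hi₀ T hT))
  have hsqrt : Tendsto (fun m => √(n m : ℝ)) atTop atTop :=
    Real.tendsto_sqrt_atTop.comp (tendsto_natCast_atTop_atTop.comp hntop)
  have hslack : ∀ᶠ m in atTop, ∀ T : Finset (Fin k), T.Nonempty → √(n m : ℝ) ≤ n m * δ T := by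
    refine eventually_all.2 fun T => ?_
    filter_upwards [hsqrt.eventually_ge_atTop (δ T)⁻¹] with m hm hT
    have h1 : 1 ≤ √(n m : ℝ) * δ T := (inv_le_iff_one_le_mul₀ (hδ T hT)).1 hm
    calc √(n m : ℝ) = √(n m : ℝ) * 1 := (mul_one _).symm
      _ ≤ √(n m : ℝ) * (√(n m : ℝ) * δ T) := by gcongr
      _ = n m * δ T := by rw [← mul_assoc, Real.mul_self_sqrt (Nat.cast_nonneg _)]
  refine squeeze_zero' (Eventually.of_forall fun m => measureReal_nonneg) ?_
    ((tendsto_errorBound (σa ^ 2) (σz ^ 2) (grid i₀) W δ).comp hntop)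
  filter_upwards [hlog, hslack, hntop.eventually_gt_atTop i₀] with m h1 h2 h3
  refine errorProb_decoder_le hk hl hσa hσz grid hW h3 hδ fun T hT => ?_
  have hmean : meanInfoDensity (σa ^ 2) (σz ^ 2) W T (grid i₀) - δ T = T.card * R + δ T := by
    rw [hδ_def]; ring
  calc T.card * Real.log m + √(n m : ℝ) ≤ T.card * (R * n m) + n m * δ T :=
        add_le_add (by gcongr) (h2 T hT)
    _ = n m * (meanInfoDensity (σa ^ 2) (σz ^ 2) W T (grid i₀) - δ T) := by rw [hmean]; ring

end Asymptotics

end SupportRecovery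

theorem theorem1 (k l : ℕ) (hk : 0 < k) (hl : 0 < l) (σa σz : ℝ) (hσa : 0 < σa) (hσz : 0 < σz)
    (n : ℕ → ℕ) (hn : ∀ m, k ≤ m → 0 < n m) :
    ∃ d : (m : ℕ) → Matrix (Fin (n m)) (Fin m) ℝ → Matrix (Fin (n m)) (Fin l) ℝ → Set (Fin m),
      (∀ m, Measurable (Function.uncurry (d m))) ∧
      ∀ W : Matrix (Fin k) (Fin l) ℝ, (∀ i j, W i j ≠ 0) →
        limsup (fun m : ℕ => ((Real.log m / n m : ℝ) : EReal)) atTop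
          < (SupportRecovery.threshold σa σz W : EReal) →
        Tendsto (fun m => SupportRecovery.errorProb σa σz W (d m)) atTop (𝓝 0) := by
  refine ⟨fun m => SupportRecovery.decoder (σa ^ 2) (σz ^ 2)
    (TopologicalSpace.denseSeq (Fin k → Fin l → ℝ)),
    fun m => SupportRecovery.measurable_decoder _ _ _, fun W hW hrate => ?_⟩
  exact SupportRecovery.tendsto_errorProb_decoder hk hl hσa hσz
    (TopologicalSpace.denseRange_denseSeq _) hn hW hrate
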